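/- **Setting.** A finite MDP $\mathcal M=(S,A,\delta)$ has finite sets $S$ of states and $A$ of actions and a partial function $\delta$ from $S\times A$ to probability distributions on $S$; $A(s)$ is the set of actions $a$ for which $\delta(s,a)$ is defined, and $A(s)\neq\emptyset$ for all $s$. A run is a sequence $\rho=s_0a_0s_1a_1\ldots$ with $\delta(s_i,a_i)(s_{i+1})>0$ for all $i$, and $\rho[n,\infty]=s_na_ns_{n+1}\ldots$. A sub-MDP consists of $S'\subseteq S$ and sets $\emptyset\ne A'(s)\subseteq A(s)$, $s\in S'$, with $\mathrm{Supp}(\delta(s,a))\subseteq S'$ for $a\in A'(s)$; it is an end-component (EC) of $\mathcal M$ if it is nonempty and its underlying graph is strongly connected. A sub-EC of an EC $\mathcal C$ is a sub-MDP of $\mathcal C$ that is an EC of $\mathcal M$. A strategy maps each history to a distribution on the actions available in its last state; it is pure if all these distributions are Dirac. It is $K$-memory if it is encoded by a Mealy machine with $K$ memory states, whose update depends on the current action, state and memory state; it is memoryless if $K=1$. An event is sure from $s$ under $\sigma$ if every run from $s$ consistent with $\sigma$ belongs to it, and almost sure if it has probability $1$ under the induced measure. **Objectives.** Let $\Omega=\mathsf{mp}$,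 with a weight function $w:A\to\mathbb Z$, or $\Omega=\mathsf{par}$, with a priority function $p:S\to\mathbb N$. For an integer $\lambda>0$, let $\mathsf{GW}_{\mathsf{mp}}(\lambda)$ be the set of runs such that $\frac1{l+1}\sum_{i=0}^{l}w(a_i)\ge0$ for some $0\le l<\lambda$, and $\mathsf{GW}_{\mathsf{par}}(\lambda)$ the set of runs such that, for some $0\le l<\lambda$, $p(s_l)$ is even and $p(s_l)<p(s_k)$ for all $k<l$. Put $$\mathsf{DFW}_\Omega(\lambda)=\{\rho\mid\forall j\ge0,\ \rho[j,\infty]\in\mathsf{GW}_\Omega(\lambda)\},\qquad \mathsf{FW}_\Omega(\lambda)=\{\rho\mid\exists i\ge0,\ \rho[i,\infty]\in\mathsf{DFW}_\Omega(\lambda)\},$$ $\mathsf{BW}_\Omega=\bigcup_{\lambda>0}\mathsf{FW}_\Omega(\lambda)$ and $\mathsf{DBW}_\Omega=\bigcup_{\lambda>0}\mathsf{DFW}_\Omega(\lambda)$. An EC $\mathcal C$ is $\lambda$-safe$_\Omega$ if some strategy in $\mathcal C$ surely satisfies $\mathsf{DFW}_\Omega(\lambda)$ from all states of $\mathcal C$.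 It is $\lambda$-good$_\Omega$ if it has a $\lambda$-safe$_\Omega$ sub-EC, and $\mathsf{BW}$-good$_\Omega$ if it has a sub-EC that is $\lambda$-safe$_\Omega$ for some $\lambda>0$. **Proposition.** 1. There is a polynomial $P$ with natural-number coefficients such that for every finite MDP $\mathcal M$, every $\Omega\in\{\mathsf{mp},\mathsf{par}\}$ (with any weight or priority function), every $\lambda>0$ and every $\lambda$-good$_\Omega$ EC $\mathcal C$ of $\mathcal M$ with state set $S_{\mathcal C}$, there is a pure strategy $\sigma$ in $\mathcal C$ that is $K$-memory for some $K\le P(|S_{\mathcal C}|+\lambda)$ and satisfies $\mathsf{FW}_\Omega(\lambda)$ almost surely from all states of $\mathcal C$. Moreover there is a $\lambda$-safe$_\Omega$ sub-EC $\mathcal C'$ of $\mathcal C$ such that, from every state of $\mathcal C$, $\sigma$ almost surely reaches $\mathcal C'$, and surely, from the first visit of $\mathcal C'$ on (if there is one), the play stays in $\mathcal C'$ and satisfies $\mathsf{DFW}_\Omega(\lambda)$. 2. For every finite MDP $\mathcal M$, every $\Omega\in\{\mathsf{mp},\mathsf{par}\}$ and every $\mathsf{BW}$-good$_\Omega$ EC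 $\mathcal C$ of $\mathcal M$, there is a pure memoryless strategy $\sigma$ in $\mathcal C$ that satisfies $\mathsf{BW}_\Omega$ almost surely from all states of $\mathcal C$. Moreover there is a sub-EC $\mathcal C'$ of $\mathcal C$, $\lambda$-safe$_\Omega$ for some $\lambda>0$, such that, from every state of $\mathcal C$, $\sigma$ almost surely reaches $\mathcal C'$, and surely, from the first visit of $\mathcal C'$ on (if there is one), the play stays in $\mathcal C'$ and satisfies $\mathsf{DBW}_\Omega$. -/

import Mathlib

open MeasureTheory ProbabilityTheory

universe u v

/-! ### Markov decision processes, sub-MDPs and end-components -/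

/-- A Markov decision process whose states are elements of `S` and whose actions are elements
of `A`. The state set is the finite set `states`; the transition function is partial on
`states × A` (`none` means undefined), maps into distributions over `states`, and there are no
deadlocks. The set of states is explicit so that a sub-MDP is again an MDP over the same types. -/
structure MDP (S A : Type*) where
  states : Finset S
  δ : S → A → Option (PMF S)
  dom : ∀ s a, (δ s a).isSome → s ∈ states
  closed : ∀ s a d, δ s a = some d → ∀ t ∈ d.support, t ∈ states
  deadlockFree : ∀ s ∈ states, ∃ a, (δ s a).isSome

/-- An infinite sequence `s₀ a₀ s₁ a₁ …` of states and actions: `ρ i = (sᵢ, aᵢ)`. -/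
abbrev Run (S A : Type*) := ℕ → S × A

namespace Run

/-- The suffix `ρ[n, ∞]`. -/
def suffix {S A : Type*} (ρ : Run S A) (n : ℕ) : Run S A := fun i => ρ (n + i)

/-- The word `s₀ a₀ … sₙ₋₁ aₙ₋₁` preceding the `n`-th state, stored with its last letter first. -/
def past {S A : Type*} (ρ : Run S A) : ℕ → List (S × A)
  | 0 => []
  | n + 1 => ρ n :: past ρ n

end Run

namespace MDP

/-- `A(s)`: the actions available in `s`. -/
def avail {S A : Type*} (M : MDP S A) (s : S) : Set A := {a | (M.δ s a).isSome}

/-- `(s, a, t) ∈ δ`: the action `a` is available in `s` and leads to `t` with positive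
probability. -/
def Step {S A : Type*} (M : MDP S A) (s : S) (a : A) (t : S) : Prop :=
  ∃ d, M.δ s a = some d ∧ t ∈ d.support

/-- The infinite sequence `ρ` is a run of `M`. -/
def IsRun {S A : Type*} (M : MDP S A) (ρ : Run S A) : Prop :=
  ∀ i, M.Step (ρ i).1 (ρ i).2 (ρ (i + 1)).1

/-- `M.IsHistory h s`: the finite sequence formed by the word `h` (last letter first) followed
by the state `s` is a history of `M`; `s` is its last state. -/
def IsHistory {S A : Type*} (M : MDP S A) : List (S × A) → S → Prop
  | [], s => s ∈ M.states
  | (t, a) :: h, s => M.IsHistory h t ∧ M.Step t a s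

/-- `M'` is a sub-MDP of `M`: its transition function is a restriction of that of `M`. That
`∅ ≠ A'(s)` and `Supp (δ (s, a)) ⊆ S'` holds because `M'` is itself an MDP. -/
def IsSubMDP {S A : Type*} (M' M : MDP S A) : Prop :=
  M'.states ⊆ M.states ∧ ∀ s a d, M'.δ s a = some d → M.δ s a = some d

/-- Every state can be reached from every state in the underlying graph. -/
def StronglyConnected {S A : Type*} (M : MDP S A) : Prop :=
  ∀ s ∈ M.states, ∀ t ∈ M.states, Relation.ReflTransGen (fun x y => ∃ a, M.Step x a y) s t

/-- `C` is an end-component of `M`: a nonempty strongly connected sub-MDP. -/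
def IsEC {S A : Type*} (C M : MDP S A) : Prop :=
  C.IsSubMDP M ∧ C.states.Nonempty ∧ C.StronglyConnected

/-- `C'` is a sub-EC of the end-component `C` of `M`. -/
def IsSubEC {S A : Type*} (C' C M : MDP S A) : Prop :=
  C'.IsSubMDP C ∧ C'.IsEC M

/-! ### Strategies -/

/-- A (history-dependent, randomized) strategy: `dist h s` is the distribution over actions
chosen after the history `h s`. Its values on sequences that are not histories are irrelevant. -/
structure Strategy {S A : Type*} (M : MDP S A) where
  dist : List (S × A) → S → PMF A
  avail : ∀ h s, M.IsHistory h s → ∀ a ∈ (dist h s).support, a ∈ M.avail s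

/-- A Mealy machine over `M` with set of memory states `Q` and a deterministic initial memory
state. -/
structure Mealy {S A : Type*} (M : MDP S A) (Q : Type*) where
  init : Q
  act : S → Q → PMF A
  upd : A → S → Q → Q
  avail : ∀ s ∈ M.states, ∀ q, ∀ a ∈ (act s q).support, a ∈ M.avail s

/-- The memory state reached after reading a word `s₀ a₀ … sₙ₋₁ aₙ₋₁` (last letter first). -/
def Mealy.mem {S A : Type*} {M : MDP S A} {Q : Type*} (m : M.Mealy Q) : List (S × A) → Q
  | [] => m.init
  | (s, a) :: h => m.upd a s (m.mem h)

namespace Strategy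

/-- All histories are mapped to Dirac distributions. -/
def IsPure {S A : Type*} {M : MDP S A} (σ : M.Strategy) : Prop :=
  ∀ h s, M.IsHistory h s → ∃ a, σ.dist h s = PMF.pure a

/-- The strategy is encoded by the Mealy machine. -/
def EncodedBy {S A : Type*} {M : MDP S A} {Q : Type*} (σ : M.Strategy) (m : M.Mealy Q) : Prop :=
  ∀ h s, M.IsHistory h s → σ.dist h s = m.act s (m.mem h)

/-- The strategy is `K`-memory: it is encoded by a Mealy machine with `K` memory states. -/
def HasMemory {S A : Type*} {M : MDP S A} (σ : M.Strategy) (K : ℕ) : Prop :=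
  ∃ m : M.Mealy (Fin K), σ.EncodedBy m

/-- A memoryless strategy is a `1`-memory one. -/
def IsMemoryless {S A : Type*} {M : MDP S A} (σ : M.Strategy) : Prop := σ.HasMemory 1

/-- `ρ` is a run from `s` consistent with the strategy `σ` (the projection to `M` of a run of the
induced Markov chain). -/
def IsOutcome {S A : Type*} {M : MDP S A} (σ : M.Strategy) (s : S) (ρ : Run S A) : Prop :=
  M.IsRun ρ ∧ (ρ 0).1 = s ∧ ∀ i, (ρ i).2 ∈ (σ.dist (ρ.past i) (ρ i).1).support

/-- The event `E` is sure from `s` under `σ`. -/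
def Sure {S A : Type*} {M : MDP S A} (σ : M.Strategy) (s : S) (E : Set (Run S A)) : Prop :=
  ∀ ρ, σ.IsOutcome s ρ → ρ ∈ E

end Strategy

end MDP

/-! ### The probability measure on runs -/

noncomputable section

/-- Letters `(s, a)` carry the discrete σ-algebra, so that `Run S A` carries the σ-algebra
generated by the cylinders. -/
abbrev letterMeasurableSpace (S A : Type*) : MeasurableSpace (S × A) := ⊤

namespace MDP.Strategy

section RunMeasure

attribute [local instance] letterMeasurableSpace

/-- The law of the next letter `(s', a')` after the word `h` followed by the letter `x = (s, a)`:
`s'` is drawn from `δ (s, a)`, then `a'` from the strategy. If `δ (s, a)` is undefined (which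
has probability zero), a dummy value is used. -/
def nextLetter {S A : Type*} {M : MDP S A} (σ : M.Strategy) (h : List (S × A)) (x : S × A) :
    PMF (S × A) :=
  match M.δ x.1 x.2 with
  | none => PMF.pure x
  | some d => d.bind fun s' => (σ.dist (x :: h) s').map fun a' => (s', a')

/-- The word `x₀ … xₙ`, seen as an infinite one that is constant from `n` on. -/
def extend {S A : Type*} (n : ℕ) (x : (i : Finset.Iic n) → S × A) : Run S A :=
  fun i => x ⟨min i n, Finset.mem_Iic.2 (min_le_right i n)⟩

/-- The transition kernel from words `x₀ … xₙ` to the next letter. -/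
def stepKernel {S A : Type*} [Finite S] [Finite A] {M : MDP S A} (σ : M.Strategy) (n : ℕ) :
    Kernel ((i : Finset.Iic n) → S × A) (S × A) :=
  Kernel.ofFunOfCountable fun x =>
    (σ.nextLetter ((extend n x).past n) (extend n x n)).toMeasure

instance {S A : Type*} [Finite S] [Finite A] {M : MDP S A} (σ : M.Strategy) (n : ℕ) :
    IsMarkovKernel (σ.stepKernel n) :=
  ⟨fun x => inferInstanceAs (IsProbabilityMeasure
    (σ.nextLetter ((extend n x).past n) (extend n x n)).toMeasure)⟩

/-- The law of the first letter `(s, a)`: `s` is the initial state and `a` is drawn from the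
strategy. -/
def firstLetter {S A : Type*} {M : MDP S A} (σ : M.Strategy) (s : S) :
    PMF ((_ : Finset.Iic 0) → S × A) :=
  (σ.dist [] s).map fun a _ => (s, a)

/-- The probability measure on runs induced by the strategy `σ` and the initial state `s`,
obtained from the transition kernels by the Ionescu-Tulcea theorem. -/
def runMeasure {S A : Type*} [Finite S] [Finite A] {M : MDP S A} (σ : M.Strategy) (s : S) :
    Measure (Run S A) :=
  (σ.firstLetter s).toMeasure.bind (Kernel.traj (X := fun _ => S × A) σ.stepKernel 0)

/-- The event `E` is almost sure from `s` under `σ`. -/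
def AlmostSure {S A : Type*} [Finite S] [Finite A] {M : MDP S A} (σ : M.Strategy) (s : S)
    (E : Set (Run S A)) : Prop :=
  σ.runMeasure s E = 1

end RunMeasure

end MDP.Strategy

end

/-! ### Window objectives -/

/-- The two kinds of window objectives with their data: mean-payoff for a weight function on
actions, and parity for a priority function on states. -/
inductive WindowKind (S A : Type*) where
  | mp (w : A → ℤ) : WindowKind S A
  | par (p : S → ℕ) : WindowKind S A

/-- The mean-payoff of the prefix `ρ[0, n]`, for `n > 0`. -/
def Run.meanPayoff {S A : Type*} (w : A → ℤ) (ρ : Run S A) (n : ℕ) : ℚ :=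
  (1 / (n : ℚ)) * ∑ i ∈ Finset.range n, (w (ρ i).2 : ℚ)

namespace MDP

/-- The good window objective. -/
def GW {S A : Type*} (M : MDP S A) : WindowKind S A → ℕ → Set (Run S A)
  | .mp w, lam => {ρ | M.IsRun ρ ∧ ∃ l < lam, 0 ≤ ρ.meanPayoff w (l + 1)}
  | .par p, lam => {ρ | M.IsRun ρ ∧
      ∃ l < lam, p (ρ l).1 % 2 = 0 ∧ ∀ k < l, p (ρ l).1 < p (ρ k).1}

/-- The direct fixed window objective. -/
def DFW {S A : Type*} (M : MDP S A) (Ω : WindowKind S A) (lam : ℕ) : Set (Run S A) :=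
  {ρ | M.IsRun ρ ∧ ∀ j, ρ.suffix j ∈ M.GW Ω lam}

/-- The fixed window objective. -/
def FW {S A : Type*} (M : MDP S A) (Ω : WindowKind S A) (lam : ℕ) : Set (Run S A) :=
  {ρ | M.IsRun ρ ∧ ∃ i, ρ.suffix i ∈ M.DFW Ω lam}

/-- The bounded window objective. -/
def BW {S A : Type*} (M : MDP S A) (Ω : WindowKind S A) : Set (Run S A) :=
  {ρ | M.IsRun ρ ∧ ∃ lam > 0, ρ ∈ M.FW Ω lam}

/-- The direct bounded window objective. -/
def DBW {S A : Type*} (M : MDP S A) (Ω : WindowKind S A) : Set (Run S A) :=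
  {ρ | ∃ lam > 0, ρ ∈ M.DFW Ω lam}

/-! ### Safe and good end-components -/

/-- The end-component `C` is `lam`-safe: some strategy in `C` surely satisfies the direct fixed
window objective from all states of `C`. -/
def IsSafe {S A : Type*} (C : MDP S A) (Ω : WindowKind S A) (lam : ℕ) : Prop :=
  ∃ σ : C.Strategy, ∀ s ∈ C.states, σ.Sure s (C.DFW Ω lam)

/-- The end-component `C` of `M` is `lam`-good: it contains a `lam`-safe sub-EC. -/
def IsGood {S A : Type*} (C M : MDP S A) (Ω : WindowKind S A) (lam : ℕ) : Prop :=
  ∃ C' : MDP S A, C'.IsSubEC C M ∧ C'.IsSafe Ω lam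

/-- The end-component `C` of `M` is BW-good: it contains a sub-EC that is `lam`-safe for some
`lam > 0`. -/
def IsBWGood {S A : Type*} (C M : MDP S A) (Ω : WindowKind S A) : Prop :=
  ∃ C' : MDP S A, C'.IsSubEC C M ∧ ∃ lam > 0, C'.IsSafe Ω lam

/-- From every state of `C`, the strategy `σ` in `C` almost surely reaches `C'`, and surely (on
every consistent run), from the first visit of `C'` on the play is a run of `C'` satisfying
`E`, i.e. the strategy then stays in `C'` and is surely winning there for `E`. -/
def Strategy.ReachesThenWins {S A : Type*} [Finite S] [Finite A] {C : MDP S A}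
    (σ : C.Strategy) (C' : MDP S A) (E : Set (Run S A)) : Prop :=
  ∀ s ∈ C.states,
    σ.AlmostSure s {ρ | ∃ i, (ρ i).1 ∈ C'.states} ∧
    σ.Sure s {ρ | ∀ i, (ρ i).1 ∈ C'.states → (∀ j < i, (ρ j).1 ∉ C'.states) →
      C'.IsRun (ρ.suffix i) ∧ ρ.suffix i ∈ E}

end MDP

/-! Both kinds of windows are monitored by a monotone integer counter that starts at `start` and
closes the window on reaching `goal`: the sum of weights, or the least priority so far. An open
window never has a counter above `start`, so any play that wins it also wins, in the same time, a
window opened now. Hence only closing one window within a number of steps matters, and this is a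
finite-horizon game on pairs (state, counter value). Sure satisfaction of the direct objective by
any strategy gives a win in this game from every state with value `start` (`winStep_of_sure`).

By monotonicity, the counter values won by an action form an upper set of integers. These sets are
nested, so with `i` steps left some action is optimal for all values at once (`exists_optimal`), and
the counter need not be remembered. For a fixed length `lam`, the memory is the number of steps
left, hence `lam` memory states (`winAct_remaining`, `closes_of_remaining`).

Without a prescribed length, even that number can be dropped. In `s`, play as if the counter had the
least winnable value `v s`, with the smallest budget `r s` that wins from it. At each step that
leaves the window open, either the surplus over `v` grows or it does not shrink and `r` drops. A
bounded potential then bounds the length of every window (`exists_memoryless`).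

Finally, outside the safe sub-EC a memoryless attractor strategy is played. Strong connectedness
makes a distance to the sub-EC decrease with positive probability, so the sub-EC is reached almost
surely (`ae_reaches`). Inside it the window strategy is played, and the play cannot leave
(`exists_reachesThenWins`). -/

/-! ### Windows as counters -/

/-- An integer counter that is updated monotonically along a run and detects that a window is
closed by reaching `goal`. The potential `pot x v` measures how far the counter value `x` exceeds
a threshold `v`. -/
structure Counter (S A : Type*) where
  next : S → A → ℤ → ℤ
  start : ℤ
  goal : ℤ
  pot : ℤ → ℤ → ℤ
  next_mono : ∀ s a, Monotone (next s a)
  le_start : ∀ x < goal, x ≤ start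
  next_bdd : ∀ s a b, ∃ c, ∀ x, b ≤ next s a x → c ≤ x
  pot_mono : ∀ v, Monotone fun x => pot x v
  pot_anti : ∀ x, StrictAnti (pot x)
  pot_next : ∀ s a x v, v ≤ x → next s a x < goal →
    pot x v ≤ pot (next s a x) (next s a v)

namespace Run

variable {S A : Type*}

theorem suffix_zero (ρ : Run S A) : ρ.suffix 0 = ρ := by
  funext k
  simp [suffix]

theorem past_succ (ρ : Run S A) (n : ℕ) : ρ.past (n + 1) = ρ n :: ρ.past n := rfl

theorem past_congr {ρ ρ' : Run S A} : ∀ {n : ℕ}, (∀ i < n, ρ i = ρ' i) → ρ.past n = ρ'.past n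
  | 0, _ => rfl
  | n + 1, h => by
    rw [past_succ, past_succ, h n n.lt_succ_self,
      past_congr fun i hi => h i (hi.trans n.lt_succ_self)]

theorem exists_eq_of_mem_past {ρ : Run S A} {y : S × A} :
    ∀ {n : ℕ}, y ∈ ρ.past n → ∃ i, ρ i = y
  | 0, h => by cases h
  | n + 1, h => by
    rcases List.mem_cons.1 h with rfl | h
    · exact ⟨n, rfl⟩
    · exact exists_eq_of_mem_past h

end Run

namespace Counter

variable {S A : Type*} (c : Counter S A)

/-- The counter value after reading a word (last letter first) from the value `x`. -/
def val (x : ℤ) : List (S × A) → ℤ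
  | [] => x
  | y :: h => c.next y.1 y.2 (val x h)

/-- The window opened with counter value `x` closes within the first `i` steps of `ρ`. -/
def Closes (i : ℕ) (x : ℤ) (ρ : Run S A) : Prop := ∃ l < i, c.goal ≤ c.val x (ρ.past (l + 1))

/-- Words grow at their far end, while the window game is solved from its first move; this passes
from one view to the other. -/
theorem val_past_succ (x : ℤ) (ρ : Run S A) (n : ℕ) :
    c.val x (ρ.past (n + 1)) = c.val (c.next (ρ 0).1 (ρ 0).2 x) ((ρ.suffix 1).past n) := by
  induction n with
  | zero => rfl
  | succ n ih =>
    rw [Run.past_succ, val, ih, Run.past_succ (ρ.suffix 1), val]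
    simp [Run.suffix, add_comm]

variable {c}

theorem Closes.mono {i j : ℕ} {x : ℤ} {ρ : Run S A} (h : c.Closes i x ρ) (hij : i ≤ j) :
    c.Closes j x ρ := by
  obtain ⟨l, hl, h⟩ := h
  exact ⟨l, hl.trans_le hij, h⟩

theorem closes_succ_of_goal_le {i : ℕ} {x : ℤ} {ρ : Run S A}
    (h : c.goal ≤ c.next (ρ 0).1 (ρ 0).2 x) : c.Closes (i + 1) x ρ :=
  ⟨0, i.succ_pos, h⟩

theorem closes_succ_of_suffix {i : ℕ} {x : ℤ} {ρ : Run S A}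
    (h : c.Closes i (c.next (ρ 0).1 (ρ 0).2 x) (ρ.suffix 1)) : c.Closes (i + 1) x ρ := by
  obtain ⟨l, hl, h⟩ := h
  exact ⟨l + 1, by omega, by rwa [val_past_succ]⟩

/-- The counter for mean-payoff windows: the sum of the weights. -/
def meanPayoff (S : Type*) {A : Type*} (w : A → ℤ) : Counter S A where
  next _ a x := x + w a
  start := 0
  goal := 0
  pot x v := x - v
  next_mono _ a x y h := by simpa using h
  le_start x h := h.le
  next_bdd _ a b := ⟨b - w a, fun x h => by omega⟩
  pot_mono v x y h := by simpa using h
  pot_anti x v v' h := by simpa using h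
  pot_next _ a x v _ _ := by simp

/-- The counter for parity windows with priorities bounded by `N`: the least priority so far, or
`N + 1` when the window has just been closed. -/
def parity {S : Type*} (A : Type*) (p : S → ℕ) (N : ℕ) (hN : ∀ s, p s < N) : Counter S A where
  next s _ x := if p s % 2 = 0 ∧ (p s : ℤ) < x then N + 1 else min x (p s)
  start := N
  goal := N + 1
  -- The difference `x - v` would not do, since taking minima destroys it. But the threshold itself
  -- never increases while the window stays open.
  pot x v := -v
  next_mono s _ x y h := by
    have := hN s
    dsimp only
    split_ifs <;> omega
  le_start x h := by omega
  next_bdd s _ b := ⟨min b 0, fun x h => by split_ifs at h <;> omega⟩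
  pot_mono v x y h := le_rfl
  pot_anti x v v' h := by simpa using h
  pot_next s _ x v h h' := by
    split_ifs at h' ⊢ <;> omega

/-- The counter `c` describes the good window objectives of `M` for `Ω`. -/
def Represents (c : Counter S A) (M : MDP S A) (Ω : WindowKind S A) : Prop :=
  ∀ ρ lam, M.IsRun ρ → (ρ ∈ M.GW Ω lam ↔ c.Closes lam c.start ρ)

theorem val_meanPayoff (w : A → ℤ) (ρ : Run S A) (n : ℕ) :
    (meanPayoff S w).val 0 (ρ.past n) = ∑ i ∈ Finset.range n, w (ρ i).2 := by
  induction n with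
  | zero => rfl
  | succ n ih => rw [Run.past_succ, val, ih, Finset.sum_range_succ]; rfl

theorem represents_meanPayoff (M : MDP S A) (w : A → ℤ) :
    (meanPayoff S w).Represents M (.mp w) := by
  intro ρ lam hρ
  have key (l : ℕ) : 0 ≤ ρ.meanPayoff w (l + 1) ↔
      (meanPayoff S w).goal ≤ (meanPayoff S w).val (meanPayoff S w).start (ρ.past (l + 1)) := by
    have h : (meanPayoff S w).val (meanPayoff S w).start (ρ.past (l + 1)) = _ :=
      val_meanPayoff w ρ (l + 1)
    rw [h, Run.meanPayoff, mul_nonneg_iff_of_pos_left (by positivity), ← Int.cast_sum]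
    exact Int.cast_nonneg_iff
  constructor
  · rintro ⟨-, l, hl, h⟩
    exact ⟨l, hl, (key l).1 h⟩
  · rintro ⟨l, hl, h⟩
    exact ⟨hρ, l, hl, (key l).2 h⟩

theorem represents_parity (M : MDP S A) (p : S → ℕ) (N : ℕ) (hN : ∀ s, p s < N) :
    (parity A p N hN).Represents M (.par p) := by
  intro ρ lam hρ
  have step (n : ℕ) : (parity A p N hN).val N (ρ.past (n + 1)) =
      if p (ρ n).1 % 2 = 0 ∧ (p (ρ n).1 : ℤ) < (parity A p N hN).val N (ρ.past n) then (N : ℤ) + 1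
      else min ((parity A p N hN).val N (ρ.past n)) (p (ρ n).1) := rfl
  constructor
  · rintro ⟨-, l, hl, he, hlt⟩
    refine ⟨l, hl, ?_⟩
    have key : ∀ n ≤ l, (p (ρ l).1 : ℤ) < (parity A p N hN).val N (ρ.past n) := by
      intro n
      induction n with
      | zero => intro _; exact Int.ofNat_lt.2 (hN _)
      | succ n ih =>
        intro hn
        rw [step]
        have h1 := ih (by omega)
        have h2 := hlt n (by omega)
        have h3 := hN (ρ l).1
        split_ifs <;> omega
    change (N : ℤ) + 1 ≤ (parity A p N hN).val N _
    rw [step, if_pos ⟨he, key l le_rfl⟩]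
  · intro hex
    classical
    -- The first closing time is needed: once the goal `N + 1` has been reached, the counter forgets
    -- the priorities seen before.
    obtain ⟨l, ⟨hl, h⟩, hfind⟩ : ∃ l, (l < lam ∧ (parity A p N hN).goal ≤
        (parity A p N hN).val (parity A p N hN).start (ρ.past (l + 1))) ∧ ∀ k < l, ¬(k < lam ∧
        (parity A p N hN).goal ≤
          (parity A p N hN).val (parity A p N hN).start (ρ.past (k + 1))) :=
      ⟨Nat.find hex, Nat.find_spec hex, fun k hk => Nat.find_min hex hk⟩
    have hmin (k : ℕ) (hk : k < l) : (parity A p N hN).val N (ρ.past (k + 1)) ≤ N := by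
      by_contra hc
      exact hfind k hk ⟨hk.trans hl, Int.add_one_le_iff.2 (not_le.1 hc)⟩
    have key (k : ℕ) (hk : k < l) : ∀ n, k < n → n ≤ l →
        (parity A p N hN).val N (ρ.past n) ≤ p (ρ k).1 := by
      intro n hkn
      induction n, hkn using Nat.le_induction with
      | base =>
        intro _
        have := hmin k hk
        rw [step] at this ⊢
        split_ifs at this ⊢ <;> omega
      | succ n hn ih =>
        intro hnl
        have h1 := hmin n (by omega)
        have h2 := ih (by omega)
        rw [step] at h1 ⊢
        split_ifs at h1 ⊢ <;> omega
    have h' : (N : ℤ) + 1 ≤ (parity A p N hN).val N (ρ.past (l + 1)) := h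
    have hp := hN (ρ l).1
    rw [step] at h'
    split_ifs at h' with hc
    · refine ⟨hρ, l, hl, hc.1, fun k hk => ?_⟩
      have := key k hk l hk le_rfl
      omega
    · omega

theorem exists_represents [Finite S] (M : MDP S A) (Ω : WindowKind S A) :
    ∃ c : Counter S A, c.Represents M Ω := by
  cases Ω with
  | mp w => exact ⟨_, represents_meanPayoff M w⟩
  | par p =>
    obtain ⟨N, hN⟩ := (Set.finite_range p).bddAbove
    exact ⟨_, represents_parity M p (N + 1) fun s => Nat.lt_succ_of_le (hN ⟨s, rfl⟩)⟩

end Counter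

/-! ### The window game -/

namespace Counter

variable {S A : Type*} (c : Counter S A) (M : MDP S A)

/-- From the state `s` with counter value `x`, the controller can surely make the counter reach its
goal within `i` steps, or it is there already. -/
def Win : ℕ → S → ℤ → Prop
  | 0, _, x => c.goal ≤ x
  | i + 1, s, x => c.goal ≤ x ∨ ∃ a ∈ M.avail s, ∀ t, M.Step s a t → Win i t (c.next s a x)

/-- After choosing `a` in `s` with counter value `x`, the controller wins within `i` further
steps. -/
def WinAct (i : ℕ) (s : S) (a : A) (x : ℤ) : Prop :=
  ∀ t, M.Step s a t → c.Win M i t (c.next s a x)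

/-- After some available action in `s` with counter value `x`, the controller wins within `i`
further steps. -/
def WinStep (i : ℕ) (s : S) (x : ℤ) : Prop := ∃ a ∈ M.avail s, c.WinAct M i s a x

variable {c M}

theorem win_succ {i : ℕ} {s : S} {x : ℤ} :
    c.Win M (i + 1) s x ↔ c.goal ≤ x ∨ c.WinStep M i s x := Iff.rfl

theorem win_of_goal_le {i : ℕ} {s : S} {x : ℤ} (h : c.goal ≤ x) : c.Win M i s x := by
  cases i with
  | zero => exact h
  | succ i => exact Or.inl h

theorem Win.mono {i : ℕ} {s : S} {x y : ℤ} (h : c.Win M i s x) (hxy : x ≤ y) : c.Win M i s y := by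
  induction i generalizing s x y with
  | zero => exact le_trans h hxy
  | succ i ih =>
    rcases h with h | ⟨a, ha, h⟩
    · exact Or.inl (h.trans hxy)
    · exact Or.inr ⟨a, ha, fun t ht => ih (h t ht) (c.next_mono s a hxy)⟩

theorem WinAct.mono {i : ℕ} {s : S} {a : A} {x y : ℤ} (h : c.WinAct M i s a x) (hxy : x ≤ y) :
    c.WinAct M i s a y :=
  fun t ht => (h t ht).mono (c.next_mono s a hxy)

theorem WinStep.mono {i : ℕ} {s : S} {x y : ℤ} (h : c.WinStep M i s x) (hxy : x ≤ y) :
    c.WinStep M i s y := by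
  obtain ⟨a, ha, h⟩ := h
  exact ⟨a, ha, h.mono hxy⟩

theorem Win.succ {i : ℕ} {s : S} {x : ℤ} (h : c.Win M i s x) : c.Win M (i + 1) s x := by
  induction i generalizing s x with
  | zero => exact Or.inl h
  | succ i ih =>
    rcases h with h | ⟨a, ha, h⟩
    · exact Or.inl h
    · exact Or.inr ⟨a, ha, fun t ht => ih (h t ht)⟩

theorem Win.le {i j : ℕ} {s : S} {x : ℤ} (h : c.Win M i s x) (hij : i ≤ j) : c.Win M j s x := by
  induction j, hij using Nat.le_induction with
  | base => exact h
  | succ j _ ih => exact ih.succ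

theorem WinStep.le {i j : ℕ} {s : S} {x : ℤ} (h : c.WinStep M i s x) (hij : i ≤ j) :
    c.WinStep M j s x := by
  obtain ⟨a, ha, h⟩ := h
  exact ⟨a, ha, fun t ht => (h t ht).le hij⟩

theorem exists_step {s : S} {a : A} (ha : a ∈ M.avail s) : ∃ t, M.Step s a t := by
  obtain ⟨d, hd⟩ := Option.isSome_iff_exists.1 ha
  obtain ⟨t, ht⟩ := d.support_nonempty
  exact ⟨t, d, hd, ht⟩

theorem mem_states_of_step {s t : S} {a : A} (h : M.Step s a t) : t ∈ M.states := by
  obtain ⟨d, hd, ht⟩ := h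
  exact M.closed _ _ _ hd _ ht

variable (c M) in
/-- Winning sets of actions are upper sets of counter values, hence nested: some action is optimal
for all counter values. -/
theorem exists_optimal [Finite A] {s : S} (hs : s ∈ M.states) (i : ℕ) :
    ∃ a ∈ M.avail s, ∀ x, c.WinStep M i s x → c.WinAct M i s a x := by
  obtain ⟨a, ha, hmax⟩ := (Set.toFinite (M.avail s)).exists_maximalFor
    (fun a => {x | c.WinAct M i s a x}) _ (M.deadlockFree s hs)
  refine ⟨a, ha, fun x ⟨b, hb, hbx⟩ => ?_⟩
  by_contra hax
  -- If `b` wins at `x` and `a` does not, every value won by `a` lies above `x`, so the winning set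
  -- of `b` contains that of `a`, and maximality applies.
  refine hax (hmax hb (fun y hy => ?_) hbx)
  exact hbx.mono (not_lt.1 fun hlt => hax (WinAct.mono hy hlt.le))

variable (c M) in
theorem exists_optimal_fun [Finite A] [Nonempty A] : ∃ f : ℕ → S → A, ∀ i, ∀ s ∈ M.states,
    f i s ∈ M.avail s ∧ ∀ x, c.WinStep M i s x → c.WinAct M i s (f i s) x := by
  have h (i : ℕ) (s : S) : ∃ a, s ∈ M.states →
      a ∈ M.avail s ∧ ∀ x, c.WinStep M i s x → c.WinAct M i s a x := by
    by_cases hs : s ∈ M.states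
    · obtain ⟨a, ha⟩ := exists_optimal c M hs i
      exact ⟨a, fun _ => ha⟩
    · exact ⟨Classical.arbitrary A, fun h => (hs h).elim⟩
  choose f hf using h
  exact ⟨f, fun i s hs => hf i s hs⟩

/-- If some strategy surely closes the window, then the controller wins the window game. -/
theorem winStep_of_sure (σ : M.Strategy) {s : S} (hs : s ∈ M.states) {k : ℕ} {x : ℤ}
    (h : σ.Sure s {ρ | c.Closes (k + 1) x ρ}) : c.WinStep M k s x := by
  by_contra hlose
  have hA : Nonempty A := ⟨(M.deadlockFree s hs).choose⟩
  -- A spoiler for `σ`: it resolves the random action arbitrarily within the support, and the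
  -- successor so that the controller keeps losing. The number `i` of steps left is determined by
  -- the length of the history.
  have hex (h : List (S × A)) (s : S) : ∃ p : A × S, M.IsHistory h s →
      p.1 ∈ (σ.dist h s).support ∧ M.Step s p.1 p.2 ∧
      ∀ i, i + h.length = k → ¬c.WinAct M i s p.1 (c.val x h) →
        ¬c.Win M i p.2 (c.next s p.1 (c.val x h)) := by
    by_cases hh : M.IsHistory h s
    · obtain ⟨a, ha⟩ := (σ.dist h s).support_nonempty
      by_cases hi : ∃ i, i + h.length = k ∧ ¬c.WinAct M i s a (c.val x h)
      · obtain ⟨i, hi, hna⟩ := hi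
        obtain ⟨t, ht⟩ := not_forall.1 hna
        obtain ⟨hst, ht⟩ := Classical.not_imp.1 ht
        refine ⟨(a, t), fun _ => ⟨ha, hst, fun j hj _ => ?_⟩⟩
        obtain rfl : j = i := by omega
        exact ht
      · obtain ⟨t, ht⟩ := exists_step (σ.avail h s hh a ha)
        exact ⟨(a, t), fun _ => ⟨ha, ht, fun j hj hn => (hi ⟨j, hj, hn⟩).elim⟩⟩
    · exact ⟨(Classical.arbitrary A, s), fun h => (hh h).elim⟩
  choose f hf using hex
  let g : ℕ → List (S × A) × S := fun n =>
    Nat.rec ([], s) (fun _ y => ((y.2, (f y.1 y.2).1) :: y.1, (f y.1 y.2).2)) n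
  let ρ : Run S A := fun n => ((g n).2, (f (g n).1 (g n).2).1)
  have hpast (n : ℕ) : ρ.past n = (g n).1 := by
    induction n with
    | zero => rfl
    | succ n ih => rw [Run.past_succ, ih]
  have hlen (n : ℕ) : (g n).1.length = n := by
    induction n with
    | zero => rfl
    | succ n ih => exact congrArg (· + 1) ih
  have hhist (n : ℕ) : M.IsHistory (g n).1 (g n).2 := by
    induction n with
    | zero => exact hs
    | succ n ih => exact ⟨ih, (hf _ _ ih).2.1⟩
  have hout : σ.IsOutcome s ρ := by
    refine ⟨fun n => (hf _ _ (hhist n)).2.1, rfl, fun n => ?_⟩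
    rw [hpast]
    exact (hf _ _ (hhist n)).1
  obtain ⟨l, hl, hgoal⟩ := h ρ hout
  have key (n : ℕ) : ∀ i, i + n = k → ¬c.WinStep M i (g n).2 (c.val x (g n).1) := by
    induction n with
    | zero =>
      rintro i rfl
      exact hlose
    | succ n ih =>
      intro i hi hw
      have h1 : ¬c.WinAct M (i + 1) (g n).2 (f (g n).1 (g n).2).1 (c.val x (g n).1) :=
        fun h => ih (i + 1) (by omega)
          ⟨_, σ.avail _ _ (hhist n) _ (hf _ _ (hhist n)).1, h⟩
      exact (hf _ _ (hhist n)).2.2 (i + 1) (by rw [hlen]; omega) h1 (Or.inr hw)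
  have hn : ¬c.WinAct M (k - l) (g l).2 (f (g l).1 (g l).2).1 (c.val x (g l).1) :=
    fun h => key l (k - l) (by omega) ⟨_, σ.avail _ _ (hhist l) _ (hf _ _ (hhist l)).1, h⟩
  refine (hf _ _ (hhist l)).2.2 (k - l) (by rw [hlen]; omega) hn (win_of_goal_le ?_)
  rw [Run.past_succ, hpast] at hgoal
  exact hgoal

/-! ### Finite memory: counting the remaining steps of the window -/

open Classical in
variable (c M) in
/-- The number of steps left after the next one, when `i` steps are left in the current window. A
new window of length `L + 1` is opened when the current one is over, in particular if the
controller can only still win it with counter values at which it is closed already. -/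
noncomputable def remaining (f : ℕ → S → A) (L : ℕ) : ℕ → S → ℕ
  | 0, _ => L
  | k + 1, s => if ∀ x, c.WinAct M k s (f k s) x → c.goal ≤ x then L else k

theorem remaining_le {f : ℕ → S → A} {L i : ℕ} (hi : i ≤ L) (s : S) :
    c.remaining M f L i s ≤ L := by
  cases i with
  | zero => exact le_rfl
  | succ k =>
    rw [remaining]
    split_ifs <;> omega

/-- If the budget is not reset, the chosen action wins from some value below `goal`. That value is
at most `start`, so a window opened at this moment is won within the budget already running. -/
theorem winAct_remaining {f : ℕ → S → A} {L : ℕ}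
    (hf : ∀ i, ∀ s ∈ M.states, ∀ x, c.WinStep M i s x → c.WinAct M i s (f i s) x)
    (hL : ∀ s ∈ M.states, c.WinStep M L s c.start) {s : S} (hs : s ∈ M.states) (i : ℕ) :
    c.WinAct M (c.remaining M f L i s) s (f (c.remaining M f L i s) s) c.start := by
  cases i with
  | zero => exact hf _ _ hs _ (hL s hs)
  | succ k =>
    rw [remaining]
    split_ifs with h
    · exact hf _ _ hs _ (hL s hs)
    · obtain ⟨x, hx⟩ := not_forall.1 h
      obtain ⟨hx, hlt⟩ := Classical.not_imp.1 hx
      exact hx.mono (c.le_start x (not_le.1 hlt))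

/-- A window won with `k` further steps closes before the budget interferes: a reset happens only
where winnable values are already at the goal, and otherwise the budget decreases along with `k`.
The shift `m (n + 1)` appears because an action is chosen with the updated budget. -/
theorem closes_of_remaining {f : ℕ → S → A} {L : ℕ}
    (hf : ∀ i, ∀ s ∈ M.states, ∀ x, c.WinStep M i s x → c.WinAct M i s (f i s) x)
    {k : ℕ} {x : ℤ} {ρ : Run S A} {m : ℕ → ℕ} (hρ : M.IsRun ρ)
    (hact : ∀ n, (ρ n).2 = f (m (n + 1)) (ρ n).1)
    (hm : ∀ n, m (n + 1) = c.remaining M f L (m n) (ρ n).1)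
    (hk : m 1 = k) (hwin : c.WinAct M k (ρ 0).1 (ρ 0).2 x) : c.Closes (k + 1) x ρ := by
  induction k generalizing x ρ m with
  | zero => exact closes_succ_of_goal_le (hwin _ (hρ 0))
  | succ k ih =>
    rcases hwin _ (hρ 0) with h | h
    · exact closes_succ_of_goal_le h
    · have hs : (ρ 1).1 ∈ M.states := mem_states_of_step (hρ 0)
      have hw := hf k _ hs _ h
      have hm1 := hm 1
      rw [hk, remaining] at hm1
      split_ifs at hm1 with hreset
      · exact closes_succ_of_goal_le (hreset _ hw)
      · refine closes_succ_of_suffix (ih (ρ := ρ.suffix 1) (m := fun n => m (1 + n))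
          (fun n => hρ (1 + n)) (fun n => hact (1 + n)) (fun n => hm (1 + n)) hm1 ?_)
        change c.WinAct M k (ρ 1).1 (ρ 1).2 _
        rw [hact 1, show m (1 + 1) = k from hm1]
        exact hw

/-! ### Memoryless strategies for unspecified window lengths -/

-- Guarantees that a least winnable counter value exists: finitely many steps can make up only a
-- bounded deficit.
variable (c M) in
theorem Win.bddBelow [Finite S] [Finite A] (i : ℕ) : ∃ b, ∀ t x, c.Win M i t x → b ≤ x := by
  induction i with
  | zero => exact ⟨c.goal, fun _ _ h => h⟩
  | succ i ih =>
    obtain ⟨b, hb⟩ := ih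
    choose g hg using fun y : S × A => c.next_bdd y.1 y.2 b
    obtain ⟨m, hm⟩ := (Set.finite_range g).bddBelow
    refine ⟨min c.goal m, fun s x h => ?_⟩
    rcases h with h | ⟨a, ha, h⟩
    · exact (min_le_left _ _).trans h
    · obtain ⟨t, ht⟩ := exists_step ha
      exact (min_le_right _ _).trans ((hm ⟨(s, a), rfl⟩).trans (hg (s, a) x (hb _ _ (h t ht))))

/-- If from every state the window can surely be closed within `L + 1` steps, then some memoryless
strategy surely closes all windows within some number `N` of steps. -/
theorem exists_memoryless [Finite S] [Finite A] {f : ℕ → S → A} {L : ℕ}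
    (hf : ∀ i, ∀ s ∈ M.states, ∀ x, c.WinStep M i s x → c.WinAct M i s (f i s) x)
    (hL : ∀ s ∈ M.states, c.WinStep M L s c.start) :
    ∃ (r : S → ℕ) (N : ℕ), ∀ ρ, M.IsRun ρ → (ρ 0).1 ∈ M.states →
      (∀ n, (ρ n).2 = f (r (ρ n).1) (ρ n).1) → c.Closes N c.start ρ := by
  have hr (s : S) : ∃ k ≤ L, (∀ x, c.WinStep M L s x → c.WinStep M k s x) ∧
      ∀ j, (∀ x, c.WinStep M L s x → c.WinStep M j s x) → k ≤ j := by
    classical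
    have hex : ∃ k, ∀ x, c.WinStep M L s x → c.WinStep M k s x := ⟨L, fun _ h => h⟩
    exact ⟨Nat.find hex, Nat.find_min' hex fun _ h => h, Nat.find_spec hex,
      fun j hj => Nat.find_min' hex hj⟩
  choose r hrL hrw hrmin using hr
  have hv (s : S) : ∃ v, s ∈ M.states →
      c.WinStep M L s v ∧ ∀ x, c.WinStep M L s x → v ≤ x := by
    by_cases hs : s ∈ M.states
    · obtain ⟨b, hb⟩ := Win.bddBelow c M (L + 1)
      obtain ⟨v, hv⟩ := Int.exists_least_of_bdd (P := c.WinStep M L s)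
        ⟨b, fun x hx => hb s x (Or.inr hx)⟩ ⟨_, hL s hs⟩
      exact ⟨v, fun _ => hv⟩
    · exact ⟨0, fun h => (hs h).elim⟩
  choose v hv using hv
  -- Lexicographic order in one integer: since `0 ≤ r s ≤ L`, one unit of surplus outweighs any
  -- change of `r`.
  let μ : S → ℤ → ℤ := fun s x => c.pot x (v s) * (L + 1) - r s
  have progress {s t : S} {x : ℤ} (hs : s ∈ M.states) (ht : M.Step s (f (r s) s) t)
      (hx : c.WinStep M L s x) (hgoal : c.next s (f (r s) s) x < c.goal) :
      c.WinStep M L t (c.next s (f (r s) s) x) ∧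
        μ s x + 1 ≤ μ t (c.next s (f (r s) s) x) := by
    obtain ⟨hvw, hvmin⟩ := hv s hs
    have hw := hf _ _ hs _ (hrw s _ hvw) t ht
    set y := c.next s (f (r s) s) (v s)
    set z := c.next s (f (r s) s) x
    have hyz : y ≤ z := c.next_mono _ _ (hvmin x hx)
    have hyg : ¬c.goal ≤ y := fun h => (h.trans hyz).not_gt hgoal
    -- With budget `0` the window would close now even from `v s`, hence also from `x`.
    obtain ⟨k, hk⟩ : ∃ k, r s = k + 1 := by
      refine Nat.exists_eq_succ_of_ne_zero fun h => hyg ?_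
      rwa [h] at hw
    rw [hk] at hw
    have hw := (win_succ.1 hw).resolve_left hyg
    have hkL : k ≤ L := by have := hrL s; omega
    have hLt := hw.le hkL
    obtain ⟨htw, htmin⟩ := hv t (mem_states_of_step ht)
    refine ⟨hLt.mono hyz, ?_⟩
    have hpot : c.pot x (v s) ≤ c.pot z y := c.pot_next _ _ _ _ (hvmin x hx) hgoal
    have hrt := hrL t
    simp only [μ]
    -- Either the threshold of `t` lies strictly below `y` and the surplus gains a unit, or it
    -- equals `y`, which is won with budget `k`, so `r` drops.
    rcases (htmin y hLt).lt_or_eq with hlt | heq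
    · have hlt' : c.pot x (v s) + 1 ≤ c.pot z (v t) := hpot.trans_lt (c.pot_anti z hlt)
      have := mul_le_mul_of_nonneg_right hlt' (by positivity : (0 : ℤ) ≤ L + 1)
      rw [add_mul] at this
      omega
    · have hrk : r t ≤ k := hrmin t k fun x' hx' => hw.mono (heq ▸ htmin x' hx')
      have := mul_le_mul_of_nonneg_right hpot (by positivity : (0 : ℤ) ≤ L + 1)
      rw [heq]
      omega
  -- Open windows keep the counter at most `B`, which bounds `μ` above by `hi`; it starts at least
  -- at `lo` and gains one per step.
  set B := max c.start c.goal
  obtain ⟨hi, hhi⟩ := (Set.finite_range fun s => c.pot B (v s) * (L + 1)).bddAbove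
  obtain ⟨lo, hlo⟩ := (Set.finite_range fun s => μ s c.start).bddBelow
  refine ⟨r, (hi - lo).toNat + 1, fun ρ hρ h0 hact => ?_⟩
  by_contra hclose
  have hlt (n : ℕ) (hn : n < (hi - lo).toNat + 1) : c.val c.start (ρ.past (n + 1)) < c.goal :=
    not_le.1 fun h => hclose ⟨n, hn, h⟩
  have key (n : ℕ) (hn : n ≤ (hi - lo).toNat + 1) :
      (ρ n).1 ∈ M.states ∧ c.val c.start (ρ.past n) ≤ B ∧
      c.WinStep M L (ρ n).1 (c.val c.start (ρ.past n)) ∧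
      lo + n ≤ μ (ρ n).1 (c.val c.start (ρ.past n)) := by
    induction n with
    | zero => exact ⟨h0, le_max_left _ _, hL _ h0, by simpa using! hlo ⟨(ρ 0).1, rfl⟩⟩
    | succ n ih =>
      obtain ⟨h1, h2, h3, h4⟩ := ih (by omega)
      have hg := hlt n (by omega)
      have hval : c.val c.start (ρ.past (n + 1)) =
          c.next (ρ n).1 (f (r (ρ n).1) (ρ n).1) (c.val c.start (ρ.past n)) := by
        rw [← hact]; rfl
      have hst := hρ n
      rw [hact] at hst
      obtain ⟨h5, h6⟩ := progress h1 hst h3 (hval ▸ hg)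
      rw [← hval] at h5 h6
      refine ⟨mem_states_of_step hst, hg.le.trans (le_max_right _ _), h5, ?_⟩
      push_cast
      omega
  obtain ⟨-, h2, -, h4⟩ := key _ le_rfl
  generalize (ρ ((hi - lo).toNat + 1)).1 = s at h4
  generalize c.val c.start (ρ.past ((hi - lo).toNat + 1)) = x at h2 h4
  have h5 := mul_le_mul_of_nonneg_right (c.pot_mono (v s) h2) (by positivity : (0 : ℤ) ≤ L + 1)
  have h6 := hhi ⟨s, rfl⟩
  simp only [μ] at h4 h5 h6
  push_cast at h4
  omega

end Counter

/-! ### The probability measure on runs, one letter at a time -/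

theorem lintegral_traj_succ {X : Type*} [MeasurableSpace X] [Finite X]
    [MeasurableSingletonClass X] (κ : (n : ℕ) → Kernel ((_ : Finset.Iic n) → X) X)
    [∀ n, IsMarkovKernel (κ n)] (x : (_ : Finset.Iic 0) → X) (n : ℕ)
    (g : ((_ : Finset.Iic n) → X) → X → ENNReal) :
    ∫⁻ ρ, g (Preorder.frestrictLe n ρ) (ρ (n + 1)) ∂Kernel.traj (X := fun _ => X) κ 0 x =
      ∫⁻ ρ, ∫⁻ y, g (Preorder.frestrictLe n ρ) y ∂κ n (Preorder.frestrictLe n ρ)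
        ∂Kernel.traj (X := fun _ => X) κ 0 x := by
  have hg : Measurable (Function.uncurry g) := measurable_of_countable _
  have h := lintegral_map (μ := Kernel.traj (X := fun _ => X) κ 0 x) hg
    (g := fun ρ => (Preorder.frestrictLe n ρ, ρ (n + 1))) (by fun_prop)
  rw [← Kernel.partialTraj_compProd_eq_map_traj (Nat.zero_le n), Measure.lintegral_compProd hg,
    ← Kernel.traj_map_frestrictLe_apply,
    lintegral_map (measurable_of_countable _) (by fun_prop)] at h
  exact h.symm

theorem MDP.mem_states_of_isHistory {S A : Type*} {M : MDP S A} {h : List (S × A)} {s : S} (hs : M.IsHistory h s) :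
    s ∈ M.states := by
  cases h with
  | nil => exact hs
  | cons x h =>
    obtain ⟨-, d, hd, hs⟩ := hs
    exact M.closed _ _ _ hd _ hs

namespace MDP.Strategy

section RunMeasure

open scoped ENNReal

attribute [local instance] letterMeasurableSpace

variable {S A : Type*} [Finite S] [Finite A] {M : MDP S A} (σ : M.Strategy)

instance (s : S) : IsProbabilityMeasure (σ.runMeasure s) := by
  rw [runMeasure]
  infer_instance

theorem measurable_past_comp {β : Type*} [MeasurableSpace β] (n : ℕ)
    (f : List (S × A) → S × A → β) :
    Measurable fun ρ : Run S A => f (ρ.past n) (ρ n) := by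
  have h : (fun ρ : Run S A => f (ρ.past n) (ρ n)) =
      (fun y : (i : Finset.Iic n) → S × A => f ((extend n y).past n) (extend n y n)) ∘
        Preorder.frestrictLe n := by
    funext ρ
    have h (i : ℕ) (hi : i ≤ n) : extend n (Preorder.frestrictLe n ρ) i = ρ i := by
      simp [extend, min_eq_left hi]
    simp only [Function.comp]
    rw [h n le_rfl, Run.past_congr fun i hi => h i hi.le]
  rw [h]
  exact (measurable_of_countable _).comp (by fun_prop)

/-- The one-step Markov property, the only link to the Ionescu-Tulcea construction needed after the
first letter. -/
theorem lintegral_runMeasure_succ (s : S) (n : ℕ) (f : List (S × A) → S × A → ℝ≥0∞) :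
    ∫⁻ ρ, f (ρ.past (n + 1)) (ρ (n + 1)) ∂σ.runMeasure s =
      ∫⁻ ρ, ∫⁻ y, f (ρ.past (n + 1)) y ∂(σ.nextLetter (ρ.past n) (ρ n)).toMeasure
        ∂σ.runMeasure s := by
  have hagree (ρ : Run S A) (i : ℕ) (hi : i ≤ n) :
      extend n (Preorder.frestrictLe n ρ) i = ρ i := by
    simp [extend, min_eq_left hi]
  have hpast (ρ : Run S A) (m : ℕ) (hm : m ≤ n + 1) :
      (extend n (Preorder.frestrictLe n ρ)).past m = ρ.past m :=
    Run.past_congr fun i hi => hagree ρ i (by omega)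
  have hmeas : Measurable fun ρ : Run S A => f (ρ.past (n + 1)) (ρ (n + 1)) :=
    measurable_past_comp (n + 1) f
  have hmeas' : Measurable fun ρ : Run S A =>
      ∫⁻ y, f (ρ.past (n + 1)) y ∂(σ.nextLetter (ρ.past n) (ρ n)).toMeasure :=
    measurable_past_comp n fun h x => ∫⁻ y, f (x :: h) y ∂(σ.nextLetter h x).toMeasure
  rw [runMeasure, Measure.lintegral_bind (Kernel.aemeasurable _) hmeas.aemeasurable,
    Measure.lintegral_bind (Kernel.aemeasurable _) hmeas'.aemeasurable]
  refine lintegral_congr fun x => ?_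
  have h1 (ρ : Run S A) : f (ρ.past (n + 1)) (ρ (n + 1)) =
      f ((extend n (Preorder.frestrictLe n ρ)).past (n + 1)) (ρ (n + 1)) := by
    rw [hpast ρ (n + 1) le_rfl]
  simp only [h1]
  rw [lintegral_traj_succ σ.stepKernel x n fun y => f ((extend n y).past (n + 1))]
  refine lintegral_congr fun ρ => ?_
  change ∫⁻ y, f ((extend n (Preorder.frestrictLe n ρ)).past (n + 1)) y
    ∂(σ.nextLetter ((extend n (Preorder.frestrictLe n ρ)).past n)
      (extend n (Preorder.frestrictLe n ρ) n)).toMeasure = _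
  rw [hpast ρ _ le_rfl, hpast ρ n n.le_succ, hagree ρ n le_rfl]

theorem ae_zero (s : S) :
    ∀ᵐ ρ ∂σ.runMeasure s, (ρ 0).1 = s ∧ (ρ 0).2 ∈ (σ.dist [] s).support := by
  have hmeas : MeasurableSet {ρ : Run S A | (ρ 0).1 = s ∧ (ρ 0).2 ∈ (σ.dist [] s).support} :=
    measurableSet_setOfPred.2 (measurable_past_comp 0
      fun _ x => x.1 = s ∧ x.2 ∈ (σ.dist [] s).support)
  rw [ae_iff, ← Set.compl_ofPred, runMeasure,
    Measure.bind_apply hmeas.compl (Kernel.aemeasurable _),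
    lintegral_eq_zero_iff (Kernel.measurable_coe _ hmeas.compl)]
  have hsupp : (σ.firstLetter s).toMeasure
      {x | (x ⟨0, by simp⟩).1 = s ∧ (x ⟨0, by simp⟩).2 ∈ (σ.dist [] s).support}ᶜ = 0 := by
    rw [PMF.toMeasure_apply_eq_zero_iff _ (Set.to_countable _).measurableSet,
      Set.disjoint_compl_right_iff_subset]
    intro x hx
    rw [firstLetter, PMF.mem_support_map_iff] at hx
    obtain ⟨a, ha, rfl⟩ := hx
    exact ⟨rfl, ha⟩
  filter_upwards [measure_eq_zero_iff_ae_notMem.1 hsupp] with x hx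
  have hx := Set.notMem_compl_iff.1 hx
  have h0 : ∀ᵐ ρ ∂Kernel.traj (X := fun _ => S × A) σ.stepKernel 0 x, ρ 0 = x ⟨0, by simp⟩ := by
    have h := Kernel.traj_map_frestrictLe_apply (X := fun _ => S × A) (κ := σ.stepKernel) 0 0 x
    rw [Kernel.partialTraj_self, Kernel.id_apply] at h
    have h' : ∀ᵐ y ∂(Kernel.traj (X := fun _ => S × A) σ.stepKernel 0 x).map
        (Preorder.frestrictLe 0), y = x := by
      rw [h, ae_dirac_eq]
      exact rfl
    filter_upwards [ae_of_ae_map (by fun_prop) h'] with ρ hρ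
    rw [← hρ]
    rfl
  refine measure_eq_zero_iff_ae_notMem.2 ?_
  filter_upwards [h0] with ρ hρ
  rw [Set.notMem_compl_iff]
  exact ⟨hρ ▸ hx.1, hρ ▸ hx.2⟩

theorem ae_succ (s : S) (n : ℕ) :
    ∀ᵐ ρ ∂σ.runMeasure s, ρ (n + 1) ∈ (σ.nextLetter (ρ.past n) (ρ n)).support := by
  classical
  let f : List (S × A) → S × A → ℝ≥0∞ := fun h y =>
    match h with
    | [] => 0
    | x :: h => if y ∈ (σ.nextLetter h x).support then 0 else 1
  have h := σ.lintegral_runMeasure_succ s n f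
  have hzero (ρ : Run S A) :
      ∫⁻ y, f (ρ.past (n + 1)) y ∂(σ.nextLetter (ρ.past n) (ρ n)).toMeasure = 0 := by
    rw [lintegral_eq_zero_iff measurable_from_top]
    have hs : (σ.nextLetter (ρ.past n) (ρ n)).toMeasure
        (σ.nextLetter (ρ.past n) (ρ n)).supportᶜ = 0 :=
      (PMF.toMeasure_apply_eq_zero_iff _ MeasurableSpace.measurableSet_top).2 disjoint_compl_right
    filter_upwards [measure_eq_zero_iff_ae_notMem.1 hs] with y hy
    exact if_pos (Set.notMem_compl_iff.1 hy)
  simp only [hzero, lintegral_zero] at h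
  rw [lintegral_eq_zero_iff (measurable_past_comp (n + 1) f)] at h
  filter_upwards [h] with ρ hρ
  by_contra hc
  exact one_ne_zero ((if_neg hc).symm.trans hρ)

/-- Lets sure statements about consistent runs be used almost surely. Along a history the chosen
action is available, so the dummy value in `nextLetter` never occurs. -/
theorem ae_isOutcome {s : S} (hs : s ∈ M.states) : ∀ᵐ ρ ∂σ.runMeasure s, σ.IsOutcome s ρ := by
  filter_upwards [σ.ae_zero s, ae_all_iff.2 (σ.ae_succ s)] with ρ h0 h
  have step (n : ℕ) (hd : (M.δ (ρ n).1 (ρ n).2).isSome) :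
      M.Step (ρ n).1 (ρ n).2 (ρ (n + 1)).1 ∧
        (ρ (n + 1)).2 ∈ (σ.dist (ρ.past (n + 1)) (ρ (n + 1)).1).support := by
    obtain ⟨d, hd⟩ := Option.isSome_iff_exists.1 hd
    have h := h n
    simp only [nextLetter, hd] at h
    rw [PMF.mem_support_bind_iff] at h
    obtain ⟨t, ht, h⟩ := h
    rw [PMF.mem_support_map_iff] at h
    obtain ⟨a, ha, h⟩ := h
    rw [← h]
    exact ⟨⟨d, hd, ht⟩, ha⟩
  have key (n : ℕ) : M.IsHistory (ρ.past n) (ρ n).1 ∧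
      (ρ n).2 ∈ (σ.dist (ρ.past n) (ρ n).1).support := by
    induction n with
    | zero => rw [h0.1]; exact ⟨hs, h0.2⟩
    | succ n ih =>
      obtain ⟨h1, h2⟩ := step n (σ.avail _ _ ih.1 _ ih.2)
      exact ⟨⟨ih.1, h1⟩, h2⟩
  exact ⟨fun n => (step n (σ.avail _ _ (key n).1 _ (key n).2)).1, h0.1, fun n => (key n).2⟩

theorem almostSure_of_ae {s : S} {E : Set (Run S A)} (h : ∀ᵐ ρ ∂σ.runMeasure s, ρ ∈ E) :
    σ.AlmostSure s E := by
  exact (measure_congr (Filter.eventuallyEq_univ.2 h)).trans measure_univ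

theorem exists_pos_le_apply (M : MDP S A) : ∃ p : ℝ≥0∞, p ≠ 0 ∧ p ≤ 1 ∧
    ∀ s a d t, M.δ s a = some d → t ∈ d.support → p ≤ d t := by
  classical
  cases nonempty_fintype S
  cases nonempty_fintype A
  let g : S × A × S → ℝ≥0∞ := fun x =>
    match M.δ x.1 x.2.1 with
    | none => 1
    | some d => if d x.2.2 = 0 then 1 else d x.2.2
  refine ⟨Finset.univ.inf g ⊓ 1, (lt_inf_iff.2 ⟨?_, zero_lt_one⟩).ne', inf_le_right,
    fun s a d t hd ht => ?_⟩
  · rw [Finset.lt_inf_iff ENNReal.zero_lt_top]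
    rintro ⟨s, a, t⟩ -
    simp only [g]
    split
    · exact zero_lt_one
    · split_ifs with h
      · exact zero_lt_one
      · exact pos_iff_ne_zero.2 h
  · refine inf_le_left.trans ((Finset.inf_le (Finset.mem_univ (s, a, t))).trans ?_)
    simp only [g, hd]
    rw [if_neg ((PMF.mem_support_iff _ _).1 ht)]

omit [Finite S] [Finite A] in
theorem toMeasure_nextLetter_fst {h : List (S × A)} {x : S × A} {d : PMF S}
    (hd : M.δ x.1 x.2 = some d) (t : S) :
    (σ.nextLetter h x).toMeasure {y | y.1 = t} = d t := by
  have hmap : (σ.nextLetter h x).map Prod.fst = d := by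
    simp only [nextLetter, hd]
    rw [PMF.map_bind]
    simp only [PMF.map_comp]
    have (s : S) : (Prod.fst ∘ fun a : A => (s, a)) = Function.const A s := rfl
    simp only [this, PMF.map_const, PMF.bind_pure]
  rw [PMF.toMeasure_apply_eq_toOuterMeasure_apply _ MeasurableSpace.measurableSet_top, ← hmap,
    ← PMF.toOuterMeasure_apply_singleton, PMF.toOuterMeasure_map_apply]
  rfl

/-- If outside `T` the strategy almost surely picks actions that decrease a distance to `T` with
positive probability, then `T` is reached almost surely. -/
theorem ae_reaches {s : S} (hs : s ∈ M.states) (T : Set S) (dist : S → ℕ)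
    (hdec : ∀ ρ, σ.IsOutcome s ρ → ∀ n, (ρ n).1 ∉ T →
      ∃ t, M.Step (ρ n).1 (ρ n).2 t ∧ dist t < dist (ρ n).1) :
    ∀ᵐ ρ ∂σ.runMeasure s, ∃ i, (ρ i).1 ∈ T := by
  classical
  obtain ⟨p, hp0, hp1, hp⟩ := exists_pos_le_apply M
  obtain ⟨D, hD⟩ := (Set.finite_range dist).bddAbove
  have hD (t : S) : dist t ≤ D := hD ⟨t, rfl⟩
  -- Halving `p` makes the expected value of `q ^ dist` at least double in each step outside `T`: `q
  -- ^ dist t * p = 2 * q ^ (dist t + 1)`.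
  set q : ℝ≥0∞ := p / 2
  have hq0 : q ≠ 0 := (ENNReal.half_pos hp0).ne'
  have hq2 : q + q = p := ENNReal.add_halves p
  have hq1 : q ≤ 1 := ENNReal.half_le_self.trans hp1
  -- The whole past is inspected, so the potential stays `1` after a visit even if the play leaves
  -- `T` again.
  let reached : List (S × A) → S × A → Prop := fun h x => ∃ y ∈ x :: h, y.1 ∈ T
  let f : List (S × A) → S × A → ℝ≥0∞ := fun h x => if reached h x then 1 else q ^ dist x.1
  have hf1 (h : List (S × A)) (x : S × A) : f h x ≤ 1 := by
    simp only [f]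
    split_ifs
    · exact le_rfl
    · exact pow_le_one' hq1 _
  set R : Set (Run S A) := {ρ | ∀ i, (ρ i).1 ∉ T} with hR
  have hRm : MeasurableSet R := by
    rw [hR, Set.ofPred_forall]
    exact MeasurableSet.iInter fun i =>
      measurableSet_setOfPred.2 (measurable_past_comp i fun _ x => x.1 ∉ T)
  -- On runs avoiding `T` the expected gain is at least `q ^ D`. As the potential is at most `1`,
  -- infinitely many such gains force `R` to be null.
  have hstep (n : ℕ) : ∫⁻ ρ, f (ρ.past n) (ρ n) ∂σ.runMeasure s + q ^ D * σ.runMeasure s R ≤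
      ∫⁻ ρ, f (ρ.past (n + 1)) (ρ (n + 1)) ∂σ.runMeasure s := by
    rw [lintegral_runMeasure_succ, ← lintegral_indicator_const hRm,
      ← lintegral_add_left (measurable_past_comp n f)]
    refine lintegral_mono_ae ?_
    filter_upwards [σ.ae_isOutcome hs] with ρ hρ
    by_cases hr : reached (ρ.past n) (ρ n)
    · have hnR : ρ ∉ R := by
        obtain ⟨y, hy, hyT⟩ := hr
        intro hρR
        rw [← Run.past_succ] at hy
        obtain ⟨i, rfl⟩ := Run.exists_eq_of_mem_past hy
        exact hρR i hyT
      have hone (y : S × A) : f (ρ.past (n + 1)) y = 1 := by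
        obtain ⟨z, hz, hzT⟩ := hr
        exact if_pos ⟨z, List.mem_cons_of_mem _ hz, hzT⟩
      simp only [hone, lintegral_one, measure_univ, Set.indicator_of_notMem hnR, add_zero]
      exact hf1 _ _
    · have hnT : (ρ n).1 ∉ T := fun h => hr ⟨_, List.mem_cons_self, h⟩
      obtain ⟨t, ⟨d, hd, htd⟩, hlt⟩ := hdec ρ hρ n hnT
      calc f (ρ.past n) (ρ n) + R.indicator (fun _ => q ^ D) ρ
          ≤ q ^ dist (ρ n).1 + q ^ dist (ρ n).1 := by
            refine add_le_add (if_neg hr).le ((Set.indicator_le_self' (by simp) ρ).trans ?_)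
            exact pow_le_pow_right_of_le_one' hq1 (hD _)
        _ ≤ q ^ dist t * p := by
            rw [← hq2, mul_add, ← pow_succ]
            have := pow_le_pow_right_of_le_one' hq1 hlt
            exact add_le_add this this
        _ ≤ q ^ dist t * (σ.nextLetter (ρ.past n) (ρ n)).toMeasure {y | y.1 = t} := by
            rw [σ.toMeasure_nextLetter_fst hd]
            gcongr
            exact hp _ _ _ _ hd htd
        _ = ∫⁻ y, {y : S × A | y.1 = t}.indicator (fun _ => q ^ dist t) y
              ∂(σ.nextLetter (ρ.past n) (ρ n)).toMeasure := (lintegral_indicator_const MeasurableSpace.measurableSet_top _).symm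
        _ ≤ _ := by
            refine lintegral_mono fun y => Set.indicator_le' (fun y hy => ?_) (by simp) y
            rw [← show y.1 = t from hy]
            simp only [f]
            split_ifs
            · exact pow_le_one' hq1 _
            · exact le_rfl
  have hsum (n : ℕ) : n * (q ^ D * σ.runMeasure s R) ≤
      ∫⁻ ρ, f (ρ.past n) (ρ n) ∂σ.runMeasure s := by
    induction n with
    | zero => simp
    | succ n ih =>
      refine le_trans ?_ (hstep n)
      rw [Nat.cast_succ, add_mul, one_mul]
      gcongr
  have hle (n : ℕ) : ∫⁻ ρ, f (ρ.past n) (ρ n) ∂σ.runMeasure s ≤ 1 := by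
    refine (lintegral_mono fun ρ => hf1 _ _).trans ?_
    simp
  have hzero : q ^ D * σ.runMeasure s R = 0 := by
    by_contra h
    obtain ⟨n, hn⟩ := ENNReal.exists_nat_mul_gt h ENNReal.one_ne_top
    exact (hn.trans_le ((hsum n).trans (hle n))).false
  have hR0 := (mul_eq_zero.1 hzero).resolve_left (pow_ne_zero _ hq0)
  filter_upwards [measure_eq_zero_iff_ae_notMem.1 hR0] with ρ hρ
  by_contra hc
  exact hρ fun i hi => hc ⟨i, hi⟩

end RunMeasure
end MDP.Strategy

/-! ### Reaching a sub-MDP and staying there -/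

namespace MDP

variable {S A : Type*}

section Reach

attribute [local instance] letterMeasurableSpace

theorem IsSubMDP.step {C' C : MDP S A} (h : C'.IsSubMDP C) {s t : S} {a : A}
    (hst : C'.Step s a t) : C.Step s a t := by
  obtain ⟨d, hd, ht⟩ := hst
  exact ⟨d, h.2 _ _ _ hd, ht⟩

theorem IsSubMDP.step_of_mem_avail {C' C : MDP S A} (h : C'.IsSubMDP C) {s t : S} {a : A}
    (ha : a ∈ C'.avail s) (hst : C.Step s a t) : C'.Step s a t := by
  obtain ⟨d, hd⟩ := Option.isSome_iff_exists.1 ha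
  obtain ⟨e, he, ht⟩ := hst
  obtain rfl : d = e := Option.some_injective _ ((h.2 _ _ _ hd).symm.trans he)
  exact ⟨d, hd, ht⟩

theorem IsSubMDP.avail_subset {C' C : MDP S A} (h : C'.IsSubMDP C) (s : S) :
    C'.avail s ⊆ C.avail s := fun a ha => by
  obtain ⟨d, hd⟩ := Option.isSome_iff_exists.1 ha
  exact Option.isSome_iff_exists.2 ⟨d, h.2 _ _ _ hd⟩

theorem IsSubMDP.isRun {C' C : MDP S A} (h : C'.IsSubMDP C) {ρ : Run S A} (hρ : C'.IsRun ρ) :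
    C.IsRun ρ := fun i => h.step (hρ i)

theorem IsRun.suffix {M : MDP S A} {ρ : Run S A} (h : M.IsRun ρ) (i : ℕ) :
    M.IsRun (ρ.suffix i) := fun j => h (i + j)

theorem IsSubMDP.GW_subset {C' C : MDP S A} (h : C'.IsSubMDP C) (Ω : WindowKind S A) (lam : ℕ) :
    C'.GW Ω lam ⊆ C.GW Ω lam := by
  cases Ω with
  | mp w => exact fun ρ hρ => ⟨h.isRun hρ.1, hρ.2⟩
  | par p => exact fun ρ hρ => ⟨h.isRun hρ.1, hρ.2⟩

theorem IsSubMDP.DFW_subset {C' C : MDP S A} (h : C'.IsSubMDP C) (Ω : WindowKind S A) (lam : ℕ) :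
    C'.DFW Ω lam ⊆ C.DFW Ω lam :=
  fun _ hρ => ⟨h.isRun hρ.1, fun j => h.GW_subset Ω lam (hρ.2 j)⟩

/-- In a strongly connected MDP, some memoryless choice of actions decreases a distance to a given
state with positive probability. -/
theorem StronglyConnected.exists_attractor {C : MDP S A} (h : C.StronglyConnected) [Nonempty A]
    {t₀ : S} (ht₀ : t₀ ∈ C.states) : ∃ (dist : S → ℕ) (f : S → A), ∀ s ∈ C.states, s ≠ t₀ →
      ∃ t, C.Step s (f s) t ∧ dist t < dist s := by
  classical
  let layer : ℕ → S → Prop := fun n =>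
    Nat.rec (motive := fun _ => S → Prop) (· = t₀) (fun _ D s => ∃ a t, C.Step s a t ∧ D t) n
  have hlayer (s : S) (hs : s ∈ C.states) : ∃ n, layer n s := by
    refine Relation.ReflTransGen.head_induction_on (h s hs t₀ ht₀) ⟨0, rfl⟩ ?_
    rintro x y ⟨a, hxy⟩ - ⟨n, hn⟩
    exact ⟨n + 1, a, y, hxy, hn⟩
  have hdist (s : S) : ∃ n, (∀ m, layer m s → n ≤ m) ∧ (s ∈ C.states → layer n s) := by
    by_cases hex : ∃ n, layer n s
    · exact ⟨Nat.find hex, fun m hm => Nat.find_min' hex hm, fun _ => Nat.find_spec hex⟩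
    · exact ⟨0, fun m hm => (hex ⟨m, hm⟩).elim, fun hs => (hex (hlayer s hs)).elim⟩
  choose dist hmin hdist using hdist
  have hf (s : S) : ∃ a, s ∈ C.states → s ≠ t₀ → ∃ t, C.Step s a t ∧ dist t < dist s := by
    by_cases hs : s ∈ C.states ∧ s ≠ t₀
    · have hl := hdist s hs.1
      cases hd : dist s with
      | zero => rw [hd] at hl; exact (hs.2 hl).elim
      | succ n =>
        rw [hd] at hl
        obtain ⟨a, t, hst, ht⟩ := hl
        exact ⟨a, fun _ _ => ⟨t, hst, Nat.lt_succ_of_le (hmin t n ht)⟩⟩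
    · exact ⟨Classical.arbitrary A, fun h1 h2 => (hs ⟨h1, h2⟩).elim⟩
  choose f hf using hf
  exact ⟨dist, f, hf⟩

theorem IsRun.mem_states {M : MDP S A} {ρ : Run S A} (h : M.IsRun ρ) (i : ℕ) :
    (ρ i).1 ∈ M.states := by
  obtain ⟨d, hd, -⟩ := h i
  exact M.dom _ _ (Option.isSome_iff_exists.2 ⟨d, hd⟩)

/-- A finite-memory choice of actions in a sub-MDP `C'` of a strongly connected MDP `C` whose
outcomes all belong to `E` extends to a pure strategy in `C` with the same memory that almost surely
reaches `C'` and then behaves like the given one. -/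
theorem exists_reachesThenWins [Finite S] [Finite A] {C' C : MDP S A} (hsub : C'.IsSubMDP C)
    (hne : C'.states.Nonempty) (hconn : C.StronglyConnected) {K : ℕ} (q₀ : Fin K)
    {act : S → Fin K → A} (hact : ∀ s ∈ C'.states, ∀ q, act s q ∈ C'.avail s)
    (upd : S → Fin K → Fin K) {E : Set (Run S A)}
    (hE : ∀ ρ, C'.IsRun ρ → (∃ m : ℕ → Fin K, ∀ n, (ρ n).2 = act (ρ n).1 (m n) ∧
      m (n + 1) = upd (ρ n).1 (m n)) → ρ ∈ E) :
    ∃ σ : C.Strategy, σ.IsPure ∧ σ.HasMemory K ∧ σ.ReachesThenWins C' E ∧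
      ∀ s ∈ C.states, σ.AlmostSure s {ρ | C.IsRun ρ ∧ ∃ i, ρ.suffix i ∈ E} := by
  classical
  obtain ⟨t₀, ht₀⟩ := hne
  have hA : Nonempty A := ⟨(C'.deadlockFree t₀ ht₀).choose⟩
  obtain ⟨dist, f, hf⟩ := hconn.exists_attractor (hsub.1 ht₀)
  let choice : S → Fin K → A := fun s q => if s ∈ C'.states then act s q else f s
  have hchoice (s : S) (hs : s ∈ C.states) (q : Fin K) : choice s q ∈ C.avail s := by
    by_cases hs' : s ∈ C'.states
    · simp only [choice, if_pos hs']
      exact hsub.avail_subset s (hact s hs' q)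
    · simp only [choice, if_neg hs']
      obtain ⟨t, ⟨d, hd, -⟩, -⟩ := hf s hs fun h => hs' (h ▸ ht₀)
      exact Option.isSome_iff_exists.2 ⟨d, hd⟩
  -- The memory is also updated outside `C'`, so its value on entering `C'` is uncontrolled; this is
  -- harmless because `hE` allows any initial memory state.
  let m : C.Mealy (Fin K) :=
    { init := q₀
      act := fun s q => PMF.pure (choice s q)
      upd := fun _ s q => upd s q
      avail := fun s hs q a ha => by
        rw [PMF.mem_support_pure_iff] at ha
        exact ha ▸ hchoice s hs q }
  let σ : C.Strategy :=
    { dist := fun h s => m.act s (m.mem h)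
      avail := fun h s hs => m.avail s (mem_states_of_isHistory hs) _ }
  have haction {s : S} {ρ : Run S A} (hρ : σ.IsOutcome s ρ) (n : ℕ) :
      (ρ n).2 = choice (ρ n).1 (m.mem (ρ.past n)) :=
    (PMF.mem_support_pure_iff _ _).1 (hρ.2.2 n)
  have hstay {s : S} {ρ : Run S A} (hρ : σ.IsOutcome s ρ) (i : ℕ) (hi : (ρ i).1 ∈ C'.states) :
      C'.IsRun (ρ.suffix i) ∧ ρ.suffix i ∈ E := by
    have hstep (n : ℕ) (hn : (ρ n).1 ∈ C'.states) :
        (ρ n).2 = act (ρ n).1 (m.mem (ρ.past n)) ∧ C'.Step (ρ n).1 (ρ n).2 (ρ (n + 1)).1 := by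
      have h1 : (ρ n).2 = act (ρ n).1 (m.mem (ρ.past n)) := (haction hρ n).trans (if_pos hn)
      exact ⟨h1, hsub.step_of_mem_avail (h1 ▸ hact _ hn _) (hρ.1 n)⟩
    have hmem (n : ℕ) : (ρ (i + n)).1 ∈ C'.states := by
      induction n with
      | zero => exact hi
      | succ n ih => exact Counter.mem_states_of_step (hstep _ ih).2
    have hrun : C'.IsRun (ρ.suffix i) := fun n => (hstep _ (hmem n)).2
    exact ⟨hrun, hE _ hrun ⟨fun n => m.mem (ρ.past (i + n)), fun n => ⟨(hstep _ (hmem n)).1, rfl⟩⟩⟩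
  have hreach (s : S) (hs : s ∈ C.states) :
      ∀ᵐ ρ ∂σ.runMeasure s, ∃ i, (ρ i).1 ∈ (C'.states : Set S) := by
    -- The distance is to the single state `t₀` of `C'`; it is only required to decrease outside
    -- `C'`, where the attractor action is played.
    refine σ.ae_reaches hs _ dist fun ρ hρ n hn => ?_
    have h1 : (ρ n).2 = f (ρ n).1 := (haction hρ n).trans (if_neg hn)
    rw [h1]
    exact hf _ (hρ.1.mem_states n) fun h => hn (h ▸ ht₀)
  refine ⟨σ, fun h s _ => ⟨_, rfl⟩, ⟨m, fun h s _ => rfl⟩, fun s hs => ⟨?_, ?_⟩, fun s hs => ?_⟩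
  · exact σ.almostSure_of_ae (hreach s hs)
  · exact fun ρ hρ i hi _ => hstay hρ i hi
  · refine σ.almostSure_of_ae ?_
    filter_upwards [hreach s hs, σ.ae_isOutcome hs] with ρ ⟨i, hi⟩ hρ
    exact ⟨hρ.1, i, (hstay hρ i hi).2⟩

end Reach

/-! ### Window strategies in safe sub-MDPs -/

theorem IsSafe.winStep {C : MDP S A} {Ω : WindowKind S A} {c : Counter S A}
    (hc : c.Represents C Ω) {L : ℕ} (h : C.IsSafe Ω (L + 1)) :
    ∀ s ∈ C.states, c.WinStep C L s c.start := by
  obtain ⟨σ, hσ⟩ := h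
  intro s hs
  refine Counter.winStep_of_sure σ hs fun ρ hρ => (hc ρ _ hρ.1).1 ?_
  -- The window opened at time `0` suffices, as every state serves as an initial state.
  have := (hσ s hs ρ hρ).2 0
  rwa [Run.suffix_zero] at this

/-- If a sub-MDP of a strongly connected MDP is `lam`-safe, then a pure strategy with memory `lam`
almost surely reaches it and then surely satisfies the direct fixed window objective. -/
theorem IsSafe.exists_fixedWindow [Finite S] [Finite A] {C' C : MDP S A} (hsub : C'.IsSubMDP C)
    (hne : C'.states.Nonempty) (hconn : C.StronglyConnected) {Ω : WindowKind S A} {lam : ℕ}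
    (hlam : 0 < lam) (hsafe : C'.IsSafe Ω lam) :
    ∃ σ : C.Strategy, σ.IsPure ∧ σ.HasMemory lam ∧ σ.ReachesThenWins C' (C'.DFW Ω lam) ∧
      ∀ s ∈ C.states, σ.AlmostSure s {ρ | C.IsRun ρ ∧ ∃ i, ρ.suffix i ∈ C'.DFW Ω lam} := by
  obtain ⟨L, rfl⟩ := Nat.exists_eq_add_one_of_ne_zero hlam.ne'
  obtain ⟨t, ht⟩ := id hne
  have hA : Nonempty A := ⟨(C'.deadlockFree t ht).choose⟩
  obtain ⟨c, hc⟩ := Counter.exists_represents C' Ω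
  have hL := hsafe.winStep hc
  obtain ⟨f, hf⟩ := c.exists_optimal_fun C'
  have hopt := fun i s hs => (hf i s hs).2
  -- A memory state is a budget in `0, …, L`. The initial one is immaterial, since
  -- `winAct_remaining` holds for every budget.
  refine exists_reachesThenWins hsub hne hconn 0
    (act := fun s q => f (c.remaining C' f L q s) s) (fun s hs q => (hf _ s hs).1)
    (fun s q => ⟨c.remaining C' f L q s,
      Nat.lt_succ_of_le (Counter.remaining_le (Nat.le_of_lt_succ q.2) s)⟩) ?_
  rintro ρ hρ ⟨m, hm⟩
  refine ⟨hρ, fun j => (hc _ _ (hρ.suffix j)).2 ?_⟩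
  have hsucc (n : ℕ) : (m (n + 1) : ℕ) = c.remaining C' f L (m n) (ρ n).1 :=
    congrArg Fin.val (hm n).2
  have hact (n : ℕ) : (ρ n).2 = f (m (n + 1)) (ρ n).1 := by rw [hsucc]; exact (hm n).1
  refine (Counter.closes_of_remaining hopt (ρ := ρ.suffix j) (m := fun n => m (j + n))
    (hρ.suffix j) (fun n => hact (j + n)) (fun n => hsucc (j + n)) rfl ?_).mono (m (j + 1)).2
  change c.WinAct C' (m (j + 1)) (ρ j).1 (ρ j).2 c.start
  rw [hact, hsucc]
  exact Counter.winAct_remaining hopt hL (hρ.mem_states j) _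

/-- If a sub-MDP of a strongly connected MDP is `lam`-safe, then a pure memoryless strategy almost
surely reaches it and then surely satisfies the direct bounded window objective. -/
theorem IsSafe.exists_boundedWindow [Finite S] [Finite A] {C' C : MDP S A}
    (hsub : C'.IsSubMDP C) (hne : C'.states.Nonempty) (hconn : C.StronglyConnected)
    {Ω : WindowKind S A} {lam : ℕ} (hlam : 0 < lam) (hsafe : C'.IsSafe Ω lam) :
    ∃ σ : C.Strategy, σ.IsPure ∧ σ.IsMemoryless ∧ σ.ReachesThenWins C' (C'.DBW Ω) ∧
      ∀ s ∈ C.states, σ.AlmostSure s {ρ | C.IsRun ρ ∧ ∃ i, ρ.suffix i ∈ C'.DBW Ω} := by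
  obtain ⟨L, rfl⟩ := Nat.exists_eq_add_one_of_ne_zero hlam.ne'
  obtain ⟨t, ht⟩ := id hne
  have hA : Nonempty A := ⟨(C'.deadlockFree t ht).choose⟩
  obtain ⟨c, hc⟩ := Counter.exists_represents C' Ω
  obtain ⟨f, hf⟩ := c.exists_optimal_fun C'
  obtain ⟨r, N, hN⟩ :=
    Counter.exists_memoryless (fun i s hs => (hf i s hs).2) (hsafe.winStep hc)
  refine exists_reachesThenWins hsub hne hconn (0 : Fin 1) (act := fun s _ => f (r s) s)
    (fun s hs _ => (hf _ s hs).1) (fun _ q => q) ?_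
  rintro ρ hρ ⟨m, hm⟩
  -- The bounded objective asks for a positive length, and `N` might be `0`.
  refine ⟨N + 1, N.succ_pos, hρ, fun j => (hc _ _ (hρ.suffix j)).2 ?_⟩
  exact (hN _ (hρ.suffix j) (hρ.mem_states j) fun n => (hm (j + n)).1).mono N.le_succ

theorem Strategy.AlmostSure.mono [Finite S] [Finite A] {M : MDP S A} {σ : M.Strategy} {s : S}
    {E F : Set (Run S A)} (h : σ.AlmostSure s E) (hEF : E ⊆ F) : σ.AlmostSure s F :=
  le_antisymm prob_le_one (h.symm.le.trans (measure_mono hEF))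

end MDP

theorem proposition5p5 :
    (∃ P : Polynomial ℕ, ∀ (S : Type u) (A : Type v) [Finite S] [Finite A] (M C : MDP S A)
      (Ω : WindowKind S A) (lam : ℕ), 0 < lam → C.IsEC M → C.IsGood M Ω lam →
      ∃ σ : C.Strategy,
        σ.IsPure ∧
        (∃ K ≤ P.eval (C.states.card + lam), σ.HasMemory K) ∧
        (∀ s ∈ C.states, σ.AlmostSure s (C.FW Ω lam)) ∧
        ∃ C' : MDP S A, C'.IsSubEC C M ∧ C'.IsSafe Ω lam ∧
          σ.ReachesThenWins C' (C'.DFW Ω lam)) ∧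
    (∀ (S : Type u) (A : Type v) [Finite S] [Finite A] (M C : MDP S A)
      (Ω : WindowKind S A), C.IsEC M → C.IsBWGood M Ω →
      ∃ σ : C.Strategy,
        σ.IsPure ∧
        σ.IsMemoryless ∧
        (∀ s ∈ C.states, σ.AlmostSure s (C.BW Ω)) ∧
        ∃ C' : MDP S A, C'.IsSubEC C M ∧ (∃ lam > 0, C'.IsSafe Ω lam) ∧
          σ.ReachesThenWins C' (C'.DBW Ω)) := by
  -- `lam` memory states suffice whatever the number of states, so the identity polynomial works.
  refine ⟨⟨Polynomial.X, ?_⟩, ?_⟩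
  · intro S A _ _ M C Ω lam hlam hC ⟨C', hsub, hsafe⟩
    obtain ⟨σ, hpure, hmem, hreach, hsure⟩ :=
      hsafe.exists_fixedWindow hsub.1 hsub.2.2.1 hC.2.2 hlam
    refine ⟨σ, hpure, ⟨lam, by simp, hmem⟩, fun s hs => (hsure s hs).mono ?_,
      C', hsub, hsafe, hreach⟩
    rintro ρ ⟨hρ, i, hi⟩
    exact ⟨hρ, i, hsub.1.DFW_subset Ω lam hi⟩
  · intro S A _ _ M C Ω hC ⟨C', hsub, lam, hlam, hsafe⟩
    obtain ⟨σ, hpure, hmem, hreach, hsure⟩ :=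
      hsafe.exists_boundedWindow hsub.1 hsub.2.2.1 hC.2.2 hlam
    refine ⟨σ, hpure, hmem, fun s hs => (hsure s hs).mono ?_,
      C', hsub, ⟨lam, hlam, hsafe⟩, hreach⟩
    rintro ρ ⟨hρ, i, N, hN, hi⟩
    exact ⟨hρ, N, hN, hρ, i, hsub.1.DFW_subset Ω N hi⟩
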